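/- Let $H$ be a totally disconnected, locally compact group, let $\alpha$ be a topological group automorphism of $H$, and let $G = H\rtimes_\alpha\mathbb Z$, with product $(g,m)(h,n) = (g\,\alpha^m(h),\, m+n)$ and the product topology, $\mathbb Z$ being discrete. Identify a subgroup $V$ of $H$ with the subgroup $\{(v,0) : v\in V\}$ of $G$. Suppose that $V$ is a compact open subgroup of $H$ such that $$\alpha(V) \supsetneq V \quad\text{and}\quad \bigcup_{n\in\mathbb Z}\alpha^n(V) = H.$$ For a compact open subgroup $W$ of $G$ and $x \in G$ put $s_W(x) = [xWx^{-1} : xWx^{-1}\cap W]$, and let $s(x) = \min_W s_W(x)$ be the scale of $x$, the minimum being taken over all compact open subgroups $W$ of $G$. A subsemigroup $S$ of $G$ is *s-multiplicative* if $s(xy) = s(x)s(y)$ for all $x,y\in S$; it is *multiplicative over* a compact open subgroup $W$ of $G$ if $W\subseteq S$ and $s_W(xy) = s_W(x)s_W(y)$ for all $x,y\in S$. Then the subsemigroups $$S_+ = \{(h,n)\in G : n\ge 0\} \quad\text{and}\quad S_- = \{(h,n)\in G : n\le 0\}$$ are maximal (with respect to inclusion) among the s-multiplicative subsemigroups of $G$,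 and they are the only maximal ones. Moreover, $S_+$ is multiplicative over $V$ if and only if $V$ is normal in $H$, and likewise $S_-$ is multiplicative over $V$ if and only if $V$ is normal in $H$. -/

import Mathlib

namespace ScaleSemigroup

section General

variable {G : Type*} [Group G]

/-- The conjugate subgroup `x V x⁻¹`. -/
def conjSubgroup (x : G) (V : Subgroup G) : Subgroup G :=
  V.map (MulAut.conj x).toMonoidHom

/-- The index `s_V(x) = [x V x⁻¹ : x V x⁻¹ ∩ V]`. For `V` compact and open in a topological group
it is a positive integer (an infinite index would be recorded as `0`). -/
noncomputable def scaleAt (V : Subgroup G) (x : G) : ℕ :=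
  (conjSubgroup x V ⊓ V).relIndex (conjSubgroup x V)

variable [TopologicalSpace G]

/-- The scale function: the minimum of `[x V x⁻¹ : x V x⁻¹ ∩ V]` over all compact open
subgroups `V` of `G`. -/
noncomputable def scale (x : G) : ℕ :=
  sInf {k : ℕ | ∃ V : Subgroup G,
    IsCompact (V : Set G) ∧ IsOpen (V : Set G) ∧ k = scaleAt V x}

/-- A subsemigroup on which the scale function is multiplicative. -/
def IsScaleMultiplicative (S : Subsemigroup G) : Prop :=
  ∀ x ∈ S, ∀ y ∈ S, scale (x * y) = scale x * scale y

/-- `S` is maximal, with respect to inclusion, among the scale-multiplicative subsemigroups. -/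
def IsMaximalScaleMultiplicative (S : Subsemigroup G) : Prop :=
  Maximal IsScaleMultiplicative S

/-- `V` is a compact open subgroup and the subsemigroup `S` is multiplicative over `V`. -/
structure IsMultiplicativeOver (S : Subsemigroup G) (V : Subgroup G) : Prop where
  isCompact : IsCompact (V : Set G)
  isOpen : IsOpen (V : Set G)
  subset : (V : Set G) ⊆ (S : Set G)
  map_mul : ∀ x ∈ S, ∀ y ∈ S, scaleAt V (x * y) = scaleAt V x * scaleAt V y

end General

section Semidirect

variable {H : Type*} [Group H] [TopologicalSpace H]

/-- The semidirect product `H ⋊_α ℤ`, with product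
`(g, m) (h, n) = (g α^m(h), m + n)`; here `ℤ` is written multiplicatively. -/
abbrev SemidirectInt (α : H ≃ₜ* H) : Type _ :=
  H ⋊[zpowersHom (MulAut H) α.toMulEquiv] Multiplicative ℤ

variable (α : H ≃ₜ* H)

/-- The topology on `H ⋊_α ℤ` is the product topology, `ℤ` being discrete. -/
instance : TopologicalSpace (SemidirectInt α) :=
  TopologicalSpace.induced SemidirectProduct.equivProd inferInstance

/-- `H ⋊_α ℤ` is homeomorphic to `H × ℤ`. -/
def homeoProd : SemidirectInt α ≃ₜ H × Multiplicative ℤ :=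
  SemidirectProduct.equivProd.toHomeomorphOfIsInducing ⟨rfl⟩

theorem continuous_zpow (n : ℤ) :
    Continuous (((α.toMulEquiv : MulAut H) ^ n : MulAut H) : H → H) := by
  induction n with
  | zero => simpa using continuous_id
  | succ n ih =>
    rw [zpow_add_one]
    exact ih.comp α.continuous
  | pred n ih =>
    rw [zpow_sub_one]
    exact ih.comp α.symm.continuous

instance [IsTopologicalGroup H] : IsTopologicalGroup (SemidirectInt α) where
  continuous_mul := by
    have hφ : Continuous fun p : Multiplicative ℤ × H =>
        zpowersHom (MulAut H) α.toMulEquiv p.1 p.2 :=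
      continuous_prod_of_discrete_left.2 fun m => continuous_zpow α m.toAdd
    have hl : Continuous fun x : SemidirectInt α => x.left :=
      continuous_fst.comp (homeoProd α).continuous
    have hr : Continuous fun x : SemidirectInt α => x.right :=
      continuous_snd.comp (homeoProd α).continuous
    refine (homeoProd α).isInducing.continuous_iff.2 (Continuous.prodMk ?_ ?_)
    · exact (hl.comp continuous_fst).mul
        (hφ.comp ((hr.comp continuous_fst).prodMk (hl.comp continuous_snd)))
    · exact (hr.comp continuous_fst).mul (hr.comp continuous_snd)
  continuous_inv := by
    have hφ : Continuous fun p : Multiplicative ℤ × H =>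
        zpowersHom (MulAut H) α.toMulEquiv p.1 p.2 :=
      continuous_prod_of_discrete_left.2 fun m => continuous_zpow α m.toAdd
    have hl : Continuous fun x : SemidirectInt α => x.left :=
      continuous_fst.comp (homeoProd α).continuous
    have hr : Continuous fun x : SemidirectInt α => x.right :=
      continuous_snd.comp (homeoProd α).continuous
    refine (homeoProd α).isInducing.continuous_iff.2 (Continuous.prodMk ?_ ?_)
    · exact hφ.comp (hr.inv.prodMk hl.inv)
    · exact hr.inv

instance [LocallyCompactSpace H] : LocallyCompactSpace (SemidirectInt α) :=
  (homeoProd α).isClosedEmbedding.locallyCompactSpace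

instance [TotallyDisconnectedSpace H] : TotallyDisconnectedSpace (SemidirectInt α) :=
  (homeoProd α).symm.totallyDisconnectedSpace

/-- The semigroup `S₊ = {(h, n) : n ≥ 0}`. -/
def semigroupPlus : Subsemigroup (SemidirectInt α) where
  carrier := {x | 0 ≤ x.right.toAdd}
  mul_mem' {_ _} ha hb := add_nonneg (α := ℤ) ha hb

/-- The semigroup `S₋ = {(h, n) : n ≤ 0}`. -/
def semigroupMinus : Subsemigroup (SemidirectInt α) where
  carrier := {x | x.right.toAdd ≤ 0}
  mul_mem' {_ _} ha hb := add_nonpos (α := ℤ) ha hb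

/-- The copy `{(v, 0) : v ∈ V}` in `H ⋊_α ℤ` of a subgroup `V` of `H`. -/
def embedSubgroup (V : Subgroup H) : Subgroup (SemidirectInt α) :=
  V.map SemidirectProduct.inl

end Semidirect

end ScaleSemigroup

/-! Put q = [α(V) : V] > 1. The subgroups α^k(V) increase to H, so each h lies in some α^k(V) with k
≥ 0. Let x = (h, n); then x α^k(V) x⁻¹ = h α^(k+n)(V) h⁻¹. If n ≥ 0, this is α^(k+n)(V), which
contains α^k(V) with index q^n; a subgroup expanded by x attains the minimum because the modulus of
x does not depend on the subgroup (`scaleAt_mul_relIndex_comm`). If n ≤ 0, x maps α^k(V) into itself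
and the scale is 1. Hence s(h, n) = q^max(n, 0) (`scale_semidirectInt`).

Now max(·, 0) is additive on each of the two half-lines and never on a pair of opposite signs, which
gives the maximal semigroups. For normal V, s_V is this same function; conversely, multiplying (g,
0) by (1, ±k) with g ∈ α^k(V) forces s_V(g, 0) = 1, that is, gVg⁻¹ ≤ V. -/

namespace ScaleSemigroup

/-! ### Indices of compact open subgroups and the modulus -/

section General

variable {G : Type*} [Group G]

theorem mem_conjSubgroup {x y : G} {V : Subgroup G} :
    y ∈ conjSubgroup x V ↔ x⁻¹ * y * x ∈ V := by
  simp only [conjSubgroup, Subgroup.mem_map_equiv, MulAut.conj_symm_apply]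

theorem conjSubgroup_eq_self_of_mem {x : G} {V : Subgroup G} (hx : x ∈ V) :
    conjSubgroup x V = V := by
  ext y
  rw [mem_conjSubgroup, V.mul_mem_cancel_right hx, V.mul_mem_cancel_left (V.inv_mem hx)]

theorem conjSubgroup_eq_self_of_normal (x : G) {V : Subgroup G} (hV : V.Normal) :
    conjSubgroup x V = V := by
  ext y
  rw [mem_conjSubgroup]
  refine ⟨fun h => ?_, fun h => ?_⟩
  · simpa [mul_assoc] using hV.conj_mem _ h x
  · simpa using hV.conj_mem _ h x⁻¹

theorem scaleAt_eq_relIndex (V : Subgroup G) (x : G) :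
    scaleAt V x = V.relIndex (conjSubgroup x V) :=
  Subgroup.inf_relIndex_left _ _

theorem relIndex_conjSubgroup (x : G) (A B : Subgroup G) :
    (conjSubgroup x A).relIndex (conjSubgroup x B) = A.relIndex B :=
  Subgroup.relIndex_map_map_of_injective A B (MulAut.conj x).injective

/-- For `D ≤ A ⊓ B` the quotient `[A : D] / [B : D]` does not depend on `D`. -/
theorem relIndex_mul_relIndex_comm {A B D : Subgroup G} (hA : D ≤ A) (hB : D ≤ B) :
    B.relIndex A * D.relIndex B = A.relIndex B * D.relIndex A := by
  have h1 := Subgroup.relIndex_mul_relIndex D (A ⊓ B) A (le_inf hA hB) inf_le_left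
  have h2 := Subgroup.relIndex_mul_relIndex D (A ⊓ B) B (le_inf hA hB) inf_le_right
  rw [Subgroup.inf_relIndex_left] at h1
  rw [Subgroup.inf_relIndex_right] at h2
  rw [← h1, ← h2]
  ring

variable [TopologicalSpace G]

theorem scale_eq_of_forall_le {V : Subgroup G} (hVc : IsCompact (V : Set G))
    (hVo : IsOpen (V : Set G)) {x : G}
    (h : ∀ W : Subgroup G, IsCompact (W : Set G) → IsOpen (W : Set G) →
      scaleAt V x ≤ scaleAt W x) : scale x = scaleAt V x := by
  refine IsLeast.csInf_eq ⟨⟨V, hVc, hVo, rfl⟩, ?_⟩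
  rintro k ⟨W, hWc, hWo, rfl⟩
  exact h W hWc hWo

variable [IsTopologicalGroup G]

/-- Open cosets cover a compact group finitely often; this excludes the value 0 that `relIndex`
takes at infinite index. -/
theorem relIndex_ne_zero_of_isCompact_of_isOpen {A B : Subgroup G}
    (hA : IsCompact (A : Set G)) (hB : IsOpen (B : Set G)) : B.relIndex A ≠ 0 := by
  have : CompactSpace A := isCompact_iff_compactSpace.1 hA
  have : Finite (A ⧸ B.subgroupOf A) :=
    Subgroup.quotient_finite_of_isOpen _ (hB.preimage continuous_subtype_val)
  exact Subgroup.index_ne_zero_of_finite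

theorem isCompact_conjSubgroup {V : Subgroup G} (hV : IsCompact (V : Set G)) (x : G) :
    IsCompact (conjSubgroup x V : Set G) := by
  rw [conjSubgroup, Subgroup.coe_map]
  exact hV.image (IsTopologicalGroup.continuous_conj x)

theorem isOpen_conjSubgroup {V : Subgroup G} (hV : IsOpen (V : Set G)) (x : G) :
    IsOpen (conjSubgroup x V : Set G) := by
  have : (conjSubgroup x V : Set G) = (fun y => x⁻¹ * y * x) ⁻¹' V := by
    ext y
    exact mem_conjSubgroup
  rw [this]
  exact hV.preimage (by fun_prop)

/-- The ratio `[x V x⁻¹ : x V x⁻¹ ∩ V] / [V : x V x⁻¹ ∩ V]` is the same for all compact open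
subgroups `V`: it is the modulus of conjugation by `x`. -/
theorem scaleAt_mul_relIndex_comm {V W : Subgroup G}
    (hVc : IsCompact (V : Set G)) (hVo : IsOpen (V : Set G))
    (hWc : IsCompact (W : Set G)) (hWo : IsOpen (W : Set G)) (x : G) :
    scaleAt W x * (conjSubgroup x V).relIndex V =
      scaleAt V x * (conjSubgroup x W).relIndex W := by
  rw [scaleAt_eq_relIndex, scaleAt_eq_relIndex]
  set A := conjSubgroup x W with hA
  set C := conjSubgroup x V with hC
  have hAo : IsOpen (A : Set G) := isOpen_conjSubgroup hWo x
  have hCo : IsOpen (C : Set G) := isOpen_conjSubgroup hVo x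
  have hAc : IsCompact (A : Set G) := isCompact_conjSubgroup hWc x
  have hCc : IsCompact (C : Set G) := isCompact_conjSubgroup hVc x
  -- All indices are compared through one open subgroup contained in A, W, C and V.
  set D := (A ⊓ W) ⊓ (C ⊓ V) with hD
  have hDo : IsOpen (D : Set G) := by
    simp only [hD, Subgroup.coe_inf]
    exact (hAo.inter hWo).inter (hCo.inter hVo)
  have hDA : D ≤ A := inf_le_left.trans inf_le_left
  have hDW : D ≤ W := inf_le_left.trans inf_le_right
  have hDC : D ≤ C := inf_le_right.trans inf_le_left
  have hDV : D ≤ V := inf_le_right.trans inf_le_right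
  have e1 := relIndex_mul_relIndex_comm hDA hDW
  have e2 := relIndex_mul_relIndex_comm hDC hDV
  have e3 := relIndex_mul_relIndex_comm hDA hDC
  have e4 := relIndex_mul_relIndex_comm hDW hDV
  have m1 : C.relIndex A = V.relIndex W := relIndex_conjSubgroup x V W
  have m2 : A.relIndex C = W.relIndex V := relIndex_conjSubgroup x W V
  rw [m1, m2] at e3
  have n1 := relIndex_ne_zero_of_isCompact_of_isOpen hWc hVo
  have n2 := relIndex_ne_zero_of_isCompact_of_isOpen hVc hWo
  have n3 := relIndex_ne_zero_of_isCompact_of_isOpen hAc hDo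
  have n4 := relIndex_ne_zero_of_isCompact_of_isOpen hVc hDo
  -- Equality of moduli: [C : D] / [V : D] = [A : D] / [W : D], because conjugation by x carries (V,
  -- W) to (C, A).
  have e5 : D.relIndex C * D.relIndex W = D.relIndex A * D.relIndex V := by
    apply Nat.eq_of_mul_eq_mul_left (Nat.pos_of_ne_zero (mul_ne_zero n1 n2))
    zify at e3 e4 ⊢
    linear_combination (W.relIndex V * D.relIndex W : ℤ) * e3 - (W.relIndex V * D.relIndex A) * e4
  apply Nat.eq_of_mul_eq_mul_left (Nat.pos_of_ne_zero (mul_ne_zero n3 n4))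
  zify at e1 e2 e5 ⊢
  linear_combination (-(W.relIndex A * C.relIndex V : ℤ)) * e5 +
    (C.relIndex V * D.relIndex C) * e1 - (A.relIndex W * D.relIndex A) * e2

theorem scaleAt_ne_zero {V : Subgroup G} (hVc : IsCompact (V : Set G))
    (hVo : IsOpen (V : Set G)) (x : G) : scaleAt V x ≠ 0 := by
  rw [scaleAt_eq_relIndex]
  exact relIndex_ne_zero_of_isCompact_of_isOpen (isCompact_conjSubgroup hVc x) hVo

/-- Here the modulus is s_V(x) itself, so s_W(x) is s_V(x) times the positive integer [W : W ∩
xWx⁻¹]. -/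
theorem scale_eq_scaleAt_of_le_conjSubgroup {V : Subgroup G} (hVc : IsCompact (V : Set G))
    (hVo : IsOpen (V : Set G)) {x : G} (hx : V ≤ conjSubgroup x V) :
    scale x = scaleAt V x := by
  refine scale_eq_of_forall_le hVc hVo fun W hWc hWo => ?_
  have h := scaleAt_mul_relIndex_comm hVc hVo hWc hWo x
  rw [Subgroup.relIndex_eq_one.2 hx, mul_one] at h
  rw [h]
  exact Nat.le_mul_of_pos_right _ (Nat.pos_of_ne_zero
    (relIndex_ne_zero_of_isCompact_of_isOpen hWc (isOpen_conjSubgroup hWo x)))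

theorem scale_eq_one_of_conjSubgroup_le {V : Subgroup G} (hVc : IsCompact (V : Set G))
    (hVo : IsOpen (V : Set G)) {x : G} (hx : conjSubgroup x V ≤ V) : scale x = 1 := by
  have h1 : scaleAt V x = 1 := by
    rw [scaleAt_eq_relIndex]
    exact Subgroup.relIndex_eq_one.2 hx
  rw [← h1]
  refine scale_eq_of_forall_le hVc hVo fun W hWc hWo => ?_
  rw [h1]
  exact Nat.one_le_iff_ne_zero.2 (scaleAt_ne_zero hWc hWo x)

end General

/-! ### The chain α^n(V) and conjugation in the semidirect product -/

section Semidirect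

variable {H : Type*} [Group H] [TopologicalSpace H] (α : H ≃ₜ* H)

/-- The subgroup `α^n(V)`. -/
def powSubgroup (V : Subgroup H) (n : ℤ) : Subgroup H :=
  V.map ((α.toMulEquiv : MulAut H) ^ n : MulAut H).toMonoidHom

theorem mem_powSubgroup {V : Subgroup H} {n : ℤ} {h : H} :
    h ∈ powSubgroup α V n ↔ ((α.toMulEquiv : MulAut H) ^ (-n) : MulAut H) h ∈ V := by
  rw [powSubgroup, Subgroup.mem_map_equiv, zpow_neg]
  rfl

theorem powSubgroup_zero (V : Subgroup H) : powSubgroup α V 0 = V := by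
  ext h
  simp [mem_powSubgroup]

theorem powSubgroup_powSubgroup (V : Subgroup H) (m n : ℤ) :
    powSubgroup α (powSubgroup α V m) n = powSubgroup α V (m + n) := by
  ext h
  rw [mem_powSubgroup, mem_powSubgroup, mem_powSubgroup, ← MulAut.mul_apply, ← zpow_add,
    neg_add]

theorem relIndex_powSubgroup (A B : Subgroup H) (n : ℤ) :
    (powSubgroup α A n).relIndex (powSubgroup α B n) = A.relIndex B :=
  Subgroup.relIndex_map_map_of_injective A B (MulEquiv.injective _)

theorem isCompact_powSubgroup {V : Subgroup H} (hV : IsCompact (V : Set H)) (n : ℤ) :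
    IsCompact (powSubgroup α V n : Set H) := by
  rw [powSubgroup, Subgroup.coe_map]
  exact hV.image (continuous_zpow α n)

theorem isOpen_powSubgroup {V : Subgroup H} (hV : IsOpen (V : Set H)) (n : ℤ) :
    IsOpen (powSubgroup α V n : Set H) := by
  have : (powSubgroup α V n : Set H) =
      ((α.toMulEquiv : MulAut H) ^ (-n) : MulAut H) ⁻¹' V := by
    ext h
    exact mem_powSubgroup α
  rw [this]
  exact hV.preimage (continuous_zpow α (-n))

theorem normal_powSubgroup {V : Subgroup H} (hV : V.Normal) (n : ℤ) :
    (powSubgroup α V n).Normal :=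
  hV.map _ (MulEquiv.surjective _)

theorem monotone_powSubgroup {V : Subgroup H} (hV : V ≤ powSubgroup α V 1) :
    Monotone (powSubgroup α V) := by
  refine monotone_int_of_le_succ fun n => ?_
  rw [add_comm, ← powSubgroup_powSubgroup]
  exact Subgroup.map_mono hV

theorem relIndex_powSubgroup_natCast {V : Subgroup H} (hV : V ≤ powSubgroup α V 1) (n : ℕ) :
    V.relIndex (powSubgroup α V n) = V.relIndex (powSubgroup α V 1) ^ n := by
  induction n with
  | zero => simp [powSubgroup_zero]
  | succ n ih =>
    have hn : V ≤ powSubgroup α V n := by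
      simpa [powSubgroup_zero] using monotone_powSubgroup α hV (Int.natCast_nonneg n)
    rw [Nat.cast_succ, ← Subgroup.relIndex_mul_relIndex V (powSubgroup α V n) _ hn
      (monotone_powSubgroup α hV (by lia)), ih, add_comm (n : ℤ) 1, ← powSubgroup_powSubgroup,
      relIndex_powSubgroup, pow_succ]

/-- For n ≤ 0 the inclusion is reversed and the index is 1, so truncation by `toNat` covers both
signs. -/
theorem relIndex_powSubgroup_add {V : Subgroup H} (hV : V ≤ powSubgroup α V 1) (k n : ℤ) :
    (powSubgroup α V k).relIndex (powSubgroup α V (k + n)) =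
      V.relIndex (powSubgroup α V 1) ^ n.toNat := by
  rcases le_total 0 n with hn | hn
  · lift n to ℕ using hn
    rw [add_comm, ← powSubgroup_powSubgroup, relIndex_powSubgroup,
      relIndex_powSubgroup_natCast α hV, Int.toNat_natCast]
  · rw [Int.toNat_of_nonpos hn, pow_zero, Subgroup.relIndex_eq_one]
    exact monotone_powSubgroup α hV (by lia)

theorem left_mul_semidirectInt (x y : SemidirectInt α) :
    (x * y).left =
      x.left * ((α.toMulEquiv : MulAut H) ^ x.right.toAdd : MulAut H) y.left :=
  rfl

theorem conj_inl_semidirectInt (x : SemidirectInt α) (v : H) :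
    MulAut.conj x (SemidirectProduct.inl v) = (SemidirectProduct.inl (MulAut.conj x.left
      (((α.toMulEquiv : MulAut H) ^ x.right.toAdd : MulAut H) v)) : SemidirectInt α) := by
  rw [MulAut.conj_apply, mul_inv_eq_iff_eq_mul]
  refine SemidirectProduct.ext ?_ ?_
  · rw [left_mul_semidirectInt, left_mul_semidirectInt, SemidirectProduct.right_inl, toAdd_one,
      zpow_zero, MulAut.one_apply, SemidirectProduct.left_inl, SemidirectProduct.left_inl,
      MulAut.conj_apply, inv_mul_cancel_right]
  · rw [SemidirectProduct.mul_right, SemidirectProduct.mul_right, SemidirectProduct.right_inl,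
      SemidirectProduct.right_inl, mul_one, one_mul]

theorem conjSubgroup_embedSubgroup (V : Subgroup H) (x : SemidirectInt α) :
    conjSubgroup x (embedSubgroup α V) =
      embedSubgroup α (conjSubgroup x.left (powSubgroup α V x.right.toAdd)) := by
  simp only [conjSubgroup, embedSubgroup, powSubgroup, Subgroup.map_map]
  congr 1
  exact MonoidHom.ext fun v => conj_inl_semidirectInt α x v

theorem scaleAt_embedSubgroup (V : Subgroup H) (x : SemidirectInt α) :
    scaleAt (embedSubgroup α V) x =
      V.relIndex (conjSubgroup x.left (powSubgroup α V x.right.toAdd)) := by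
  rw [scaleAt_eq_relIndex, conjSubgroup_embedSubgroup]
  exact Subgroup.relIndex_map_map_of_injective _ _ SemidirectProduct.inl_injective

theorem mem_embedSubgroup {V : Subgroup H} {x : SemidirectInt α} :
    x ∈ embedSubgroup α V ↔ x.left ∈ V ∧ x.right = 1 := by
  refine ⟨?_, fun ⟨h1, h2⟩ => ⟨x.left, h1, SemidirectProduct.ext rfl h2.symm⟩⟩
  rintro ⟨v, hv, rfl⟩
  exact ⟨hv, rfl⟩

theorem isCompact_embedSubgroup {V : Subgroup H} (hV : IsCompact (V : Set H)) :
    IsCompact (embedSubgroup α V : Set (SemidirectInt α)) := by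
  rw [embedSubgroup, Subgroup.coe_map]
  refine hV.image ((homeoProd α).isInducing.continuous_iff.2 ?_)
  exact continuous_id.prodMk continuous_const

theorem isOpen_embedSubgroup {V : Subgroup H} (hV : IsOpen (V : Set H)) :
    IsOpen (embedSubgroup α V : Set (SemidirectInt α)) := by
  have : (embedSubgroup α V : Set (SemidirectInt α)) =
      homeoProd α ⁻¹' ((V : Set H) ×ˢ {1}) := by
    ext x
    exact mem_embedSubgroup α
  rw [this]
  exact (hV.prod (isOpen_discrete _)).preimage (homeoProd α).continuous

theorem embedSubgroup_mono {V W : Subgroup H} (h : V ≤ W) :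
    embedSubgroup α V ≤ embedSubgroup α W :=
  Subgroup.map_mono h

/-! ### The scale function -/

theorem exists_mem_powSubgroup {V : Subgroup H} (hV : V ≤ powSubgroup α V 1)
    (hunion : ⋃ n : ℤ, ((α.toMulEquiv : MulAut H) ^ n : MulAut H) '' (V : Set H) = Set.univ)
    (h : H) : ∃ k : ℕ, h ∈ powSubgroup α V k := by
  obtain ⟨n, hn⟩ := Set.mem_iUnion.1 (hunion ▸ Set.mem_univ h)
  exact ⟨n.toNat, monotone_powSubgroup α hV n.self_le_toNat hn⟩

theorem scale_semidirectInt [IsTopologicalGroup H] {V : Subgroup H}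
    (hVc : IsCompact (V : Set H)) (hVo : IsOpen (V : Set H)) (hV : V ≤ powSubgroup α V 1)
    (hunion : ⋃ n : ℤ, ((α.toMulEquiv : MulAut H) ^ n : MulAut H) '' (V : Set H) = Set.univ)
    (x : SemidirectInt α) :
    scale x = V.relIndex (powSubgroup α V 1) ^ x.right.toAdd.toNat := by
  obtain ⟨k, hk⟩ := exists_mem_powSubgroup α hV hunion x.left
  have hc := isCompact_embedSubgroup α (isCompact_powSubgroup α hVc k)
  have ho := isOpen_embedSubgroup α (isOpen_powSubgroup α hVo k)
  have hmono := monotone_powSubgroup α hV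
  rcases le_total 0 x.right.toAdd with hn | hn
  · have hle : powSubgroup α V k ≤ powSubgroup α V (k + x.right.toAdd) := hmono (by lia)
    have hconj : conjSubgroup x.left (powSubgroup α (powSubgroup α V k) x.right.toAdd) =
        powSubgroup α V (k + x.right.toAdd) := by
      rw [powSubgroup_powSubgroup, conjSubgroup_eq_self_of_mem (hle hk)]
    rw [scale_eq_scaleAt_of_le_conjSubgroup hc ho, scaleAt_embedSubgroup, hconj,
      relIndex_powSubgroup_add α hV]
    rw [conjSubgroup_embedSubgroup, hconj]
    exact embedSubgroup_mono α hle
  · rw [Int.toNat_of_nonpos hn, pow_zero]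
    apply scale_eq_one_of_conjSubgroup_le hc ho
    rw [conjSubgroup_embedSubgroup, powSubgroup_powSubgroup]
    apply embedSubgroup_mono
    -- Both sides become conjugates by `x.left`, which reduces the claim to α^(k+n)(V) ≤ α^k(V).
    conv_rhs => rw [← conjSubgroup_eq_self_of_mem hk]
    exact Subgroup.map_mono (hmono (by lia))

/-! ### Maximal s-multiplicative semigroups -/

/-- If m < 0 < n, then max(m + n, 0) < n = max(m, 0) + max(n, 0). -/
theorem le_semigroupPlus_or_le_semigroupMinus {q : ℕ} (hq : 1 < q)
    (hs : ∀ x : SemidirectInt α, scale x = q ^ x.right.toAdd.toNat)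
    {S : Subsemigroup (SemidirectInt α)} (hS : IsScaleMultiplicative S) :
    S ≤ semigroupPlus α ∨ S ≤ semigroupMinus α := by
  by_contra! hcon
  obtain ⟨⟨x, hx, hx'⟩, ⟨y, hy, hy'⟩⟩ := hcon.imp SetLike.not_le_iff_exists.1
    SetLike.not_le_iff_exists.1
  have hx0 : x.right.toAdd < 0 := not_le.1 hx'
  have hy0 : 0 < y.right.toAdd := not_le.1 hy'
  have h := hS x hx y hy
  rw [hs, hs, hs, ← pow_add] at h
  have h' := Nat.pow_right_injective hq h
  rw [SemidirectProduct.mul_right, toAdd_mul] at h'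
  lia

theorem isScaleMultiplicative_semigroupPlus {q : ℕ}
    (hs : ∀ x : SemidirectInt α, scale x = q ^ x.right.toAdd.toNat) :
    IsScaleMultiplicative (semigroupPlus α) := fun x hx y hy => by
  rw [hs, hs, hs, ← pow_add, SemidirectProduct.mul_right, toAdd_mul, Int.toNat_add hx hy]

theorem isScaleMultiplicative_semigroupMinus {q : ℕ}
    (hs : ∀ x : SemidirectInt α, scale x = q ^ x.right.toAdd.toNat) :
    IsScaleMultiplicative (semigroupMinus α) := fun x hx y hy => by
  have hxy : (x * y).right.toAdd ≤ 0 := mul_mem hx hy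
  rw [hs, hs, hs, Int.toNat_of_nonpos hxy, Int.toNat_of_nonpos hx, Int.toNat_of_nonpos hy]
  simp

theorem not_semigroupPlus_le_semigroupMinus : ¬ semigroupPlus α ≤ semigroupMinus α := fun h =>
  absurd (h (show SemidirectProduct.inr (Multiplicative.ofAdd (1 : ℤ)) ∈ semigroupPlus α from
    zero_le_one (α := ℤ))) (not_le.2 (zero_lt_one (α := ℤ)))

theorem not_semigroupMinus_le_semigroupPlus : ¬ semigroupMinus α ≤ semigroupPlus α := fun h =>
  absurd (h (show SemidirectProduct.inr (Multiplicative.ofAdd (-1 : ℤ)) ∈ semigroupMinus α from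
    by show (-1 : ℤ) ≤ 0; lia)) (by show ¬ (0 : ℤ) ≤ -1; lia)

theorem isMaximalScaleMultiplicative_iff {q : ℕ} (hq : 1 < q)
    (hs : ∀ x : SemidirectInt α, scale x = q ^ x.right.toAdd.toNat)
    (S : Subsemigroup (SemidirectInt α)) :
    IsMaximalScaleMultiplicative S ↔ S = semigroupPlus α ∨ S = semigroupMinus α := by
  have hp := isScaleMultiplicative_semigroupPlus α hs
  have hm := isScaleMultiplicative_semigroupMinus α hs
  constructor
  · intro hS
    exact (le_semigroupPlus_or_le_semigroupMinus α hq hs hS.prop).imp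
      (fun h => hS.eq_of_le hp h) (fun h => hS.eq_of_le hm h)
  · rintro (rfl | rfl)
    · refine ⟨hp, fun T hT hle => ?_⟩
      exact (le_semigroupPlus_or_le_semigroupMinus α hq hs hT).resolve_right
        fun h => not_semigroupPlus_le_semigroupMinus α (hle.trans h)
    · refine ⟨hm, fun T hT hle => ?_⟩
      exact (le_semigroupPlus_or_le_semigroupMinus α hq hs hT).resolve_left
        fun h => not_semigroupMinus_le_semigroupPlus α (hle.trans h)

/-! ### Multiplicativity over V -/

theorem normal_of_scaleAt_inl_eq_one {V : Subgroup H}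
    (h : ∀ g : H, scaleAt (embedSubgroup α V) (SemidirectProduct.inl g) = 1) : V.Normal := by
  refine ⟨fun v hv g => ?_⟩
  have hg := h g
  rw [scaleAt_embedSubgroup, Subgroup.relIndex_eq_one] at hg
  apply hg
  rw [SemidirectProduct.right_inl, toAdd_one, powSubgroup_zero, SemidirectProduct.left_inl,
    mem_conjSubgroup]
  simpa [mul_assoc] using hv

theorem scaleAt_embedSubgroup_of_normal {V : Subgroup H} (hV : V ≤ powSubgroup α V 1)
    (hN : V.Normal) (x : SemidirectInt α) :
    scaleAt (embedSubgroup α V) x =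
      V.relIndex (powSubgroup α V 1) ^ x.right.toAdd.toNat := by
  rw [scaleAt_embedSubgroup, conjSubgroup_eq_self_of_normal _ (normal_powSubgroup α hN _)]
  simpa [powSubgroup_zero] using relIndex_powSubgroup_add α hV 0 x.right.toAdd

theorem isMultiplicativeOver_semigroupPlus_iff [IsTopologicalGroup H] {V : Subgroup H}
    (hVc : IsCompact (V : Set H)) (hVo : IsOpen (V : Set H)) (hV : V ≤ powSubgroup α V 1)
    (hunion : ⋃ n : ℤ, ((α.toMulEquiv : MulAut H) ^ n : MulAut H) '' (V : Set H) = Set.univ) :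
    IsMultiplicativeOver (semigroupPlus α) (embedSubgroup α V) ↔ V.Normal := by
  have hc := isCompact_embedSubgroup α hVc
  have ho := isOpen_embedSubgroup α hVo
  constructor
  · intro hM
    refine normal_of_scaleAt_inl_eq_one α fun g => ?_
    obtain ⟨k, hk⟩ := exists_mem_powSubgroup α hV hunion g
    -- Test product (g, 0)(1, k) = (g, k): as g normalizes α^k(V), its s_V equals that of (1, k),
    -- which then cancels.
    have h := hM.map_mul (SemidirectProduct.inl g) (le_refl (0 : ℤ))
      (SemidirectProduct.inr (Multiplicative.ofAdd (k : ℤ))) (Int.natCast_nonneg k)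
    have e1 : scaleAt (embedSubgroup α V) (SemidirectProduct.inl g *
        SemidirectProduct.inr (Multiplicative.ofAdd (k : ℤ))) =
        V.relIndex (powSubgroup α V k) := by
      rw [scaleAt_embedSubgroup]
      have hl : (SemidirectProduct.inl g * SemidirectProduct.inr (Multiplicative.ofAdd (k : ℤ)) :
          SemidirectInt α).left = g := mul_one g
      have hr : (SemidirectProduct.inl g * SemidirectProduct.inr (Multiplicative.ofAdd (k : ℤ)) :
          SemidirectInt α).right.toAdd = k := zero_add (k : ℤ)
      rw [hl, hr, conjSubgroup_eq_self_of_mem hk]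
    have e2 : scaleAt (embedSubgroup α V)
        (SemidirectProduct.inr (Multiplicative.ofAdd (k : ℤ))) =
        V.relIndex (powSubgroup α V k) := by
      rw [scaleAt_embedSubgroup, SemidirectProduct.left_inr, SemidirectProduct.right_inr,
        toAdd_ofAdd, conjSubgroup_eq_self_of_mem (one_mem _)]
    have h0 := scaleAt_ne_zero hc ho (SemidirectProduct.inr (Multiplicative.ofAdd (k : ℤ)))
    rw [e1, e2] at h
    rw [e2] at h0
    exact (mul_eq_right₀ h0).1 h.symm
  · intro hN
    refine ⟨hc, ho, fun x hx => ?_, fun x hx y hy => ?_⟩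
    · exact ((congrArg Multiplicative.toAdd ((mem_embedSubgroup α).1 hx).2).symm).le
    · simp only [scaleAt_embedSubgroup_of_normal α hV hN]
      rw [← pow_add, SemidirectProduct.mul_right, toAdd_mul, Int.toNat_add hx hy]

theorem isMultiplicativeOver_semigroupMinus_iff [IsTopologicalGroup H] {V : Subgroup H}
    (hVc : IsCompact (V : Set H)) (hVo : IsOpen (V : Set H)) (hV : V ≤ powSubgroup α V 1)
    (hunion : ⋃ n : ℤ, ((α.toMulEquiv : MulAut H) ^ n : MulAut H) '' (V : Set H) = Set.univ) :
    IsMultiplicativeOver (semigroupMinus α) (embedSubgroup α V) ↔ V.Normal := by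
  have hc := isCompact_embedSubgroup α hVc
  have ho := isOpen_embedSubgroup α hVo
  constructor
  · intro hM
    refine normal_of_scaleAt_inl_eq_one α fun g => ?_
    obtain ⟨k, hk⟩ := exists_mem_powSubgroup α hV hunion g
    -- In this order the product is (α^(-k)(g), -k) with α^(-k)(g) ∈ V. It conjugates V into V, so
    -- both factors have s_V equal to 1.
    have h := hM.map_mul (SemidirectProduct.inr (Multiplicative.ofAdd (-k : ℤ)))
      (Int.neg_nonpos_of_nonneg (Int.natCast_nonneg k))
      (SemidirectProduct.inl g) (le_refl (0 : ℤ))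
    have e1 : scaleAt (embedSubgroup α V)
        (SemidirectProduct.inr (Multiplicative.ofAdd (-k : ℤ)) * SemidirectProduct.inl g) =
        1 := by
      rw [scaleAt_embedSubgroup, Subgroup.relIndex_eq_one]
      have hg : ((α.toMulEquiv : MulAut H) ^ (-k : ℤ) : MulAut H) g ∈ V :=
        (mem_powSubgroup α).1 hk
      conv_rhs => rw [← conjSubgroup_eq_self_of_mem hg]
      have hle : powSubgroup α V (-k) ≤ V := by
        simpa [powSubgroup_zero] using monotone_powSubgroup α hV
          (Int.neg_nonpos_of_nonneg (Int.natCast_nonneg k))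
      have hl : (SemidirectProduct.inr (Multiplicative.ofAdd (-k : ℤ)) * SemidirectProduct.inl g :
          SemidirectInt α).left = ((α.toMulEquiv : MulAut H) ^ (-k : ℤ) : MulAut H) g :=
        one_mul _
      have hr : (SemidirectProduct.inr (Multiplicative.ofAdd (-k : ℤ)) * SemidirectProduct.inl g :
          SemidirectInt α).right.toAdd = -k := add_zero (-k : ℤ)
      rw [hl, hr]
      exact Subgroup.map_mono hle
    rw [e1] at h
    exact Nat.eq_one_of_mul_eq_one_left h.symm
  · intro hN
    refine ⟨hc, ho, fun x hx => ?_, fun x hx y hy => ?_⟩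
    · exact (congrArg Multiplicative.toAdd ((mem_embedSubgroup α).1 hx).2).le
    · have hxy : (x * y).right.toAdd ≤ 0 := mul_mem hx hy
      simp only [scaleAt_embedSubgroup_of_normal α hV hN]
      rw [Int.toNat_of_nonpos hxy, Int.toNat_of_nonpos hx, Int.toNat_of_nonpos hy]
      simp

end Semidirect

end ScaleSemigroup

theorem mainTheorem4 {H : Type*} [Group H] [TopologicalSpace H] [IsTopologicalGroup H]
    [LocallyCompactSpace H] [TotallyDisconnectedSpace H]
    (α : H ≃ₜ* H) (V : Subgroup H)
    (hVc : IsCompact (V : Set H)) (hVo : IsOpen (V : Set H))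
    (hlt : V < V.map α.toMulEquiv.toMonoidHom)
    (hunion : ⋃ n : ℤ, ((α.toMulEquiv : MulAut H) ^ n : MulAut H) '' (V : Set H) = Set.univ) :
    (∀ S : Subsemigroup (ScaleSemigroup.SemidirectInt α),
      ScaleSemigroup.IsMaximalScaleMultiplicative S ↔
        S = ScaleSemigroup.semigroupPlus α ∨ S = ScaleSemigroup.semigroupMinus α) ∧
    (ScaleSemigroup.IsMultiplicativeOver (ScaleSemigroup.semigroupPlus α)
      (ScaleSemigroup.embedSubgroup α V) ↔ V.Normal) ∧
    (ScaleSemigroup.IsMultiplicativeOver (ScaleSemigroup.semigroupMinus α)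
      (ScaleSemigroup.embedSubgroup α V) ↔ V.Normal) := by
  have h1 : ScaleSemigroup.powSubgroup α V 1 = V.map α.toMulEquiv.toMonoidHom := by
    rw [ScaleSemigroup.powSubgroup, zpow_one]
  rw [← h1] at hlt
  -- The index is not 0 by compactness and openness, and not 1 because the inclusion is strict.
  have hq : 1 < V.relIndex (ScaleSemigroup.powSubgroup α V 1) := by
    have h0 := ScaleSemigroup.relIndex_ne_zero_of_isCompact_of_isOpen
      (ScaleSemigroup.isCompact_powSubgroup α hVc 1) hVo
    have h1 := mt Subgroup.relIndex_eq_one.1 (not_le_of_gt hlt)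
    lia
  exact ⟨ScaleSemigroup.isMaximalScaleMultiplicative_iff α hq
      (ScaleSemigroup.scale_semidirectInt α hVc hVo hlt.le hunion),
    ScaleSemigroup.isMultiplicativeOver_semigroupPlus_iff α hVc hVo hlt.le hunion,
    ScaleSemigroup.isMultiplicativeOver_semigroupMinus_iff α hVc hVo hlt.le hunion⟩
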